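/- Let $\mathfrak G=\mathbb Z[i]\subset\mathbb C$ be the ring of Gaussian integers, and let $f:\mathbb C\to\mathfrak G$ assign to each $z$ a Gaussian integer nearest to it (ties being broken by any fixed convention). The *Hurwitz expansion* of $z\in\mathbb C$ is the sequence $a_n=f(z_n)$, where $z_0=z$ and $z_{n+1}=(z_n-f(z_n))^{-1}$, the sequence being terminated at $a_n$ if $f(z_n)=z_n$. Let $S=\{x+iy : |x|<\tfrac12,\ |y|<\tfrac12\}$. A finite block $\beta=(b_1,\dots,b_l)$ of Gaussian integers with $|b_j|>1$ for all $j$ is called *admissible* if the set $S_\beta$ of all $z\in S$ whose Hurwitz expansion satisfies $(a_1,\dots,a_l)=\beta$ has nonempty interior in $\mathbb C$. A complex number $z$ whose real or imaginary part is irrational is called *generic* if every admissible block occurs as a block of consecutive terms in the Hurwitz expansion of $z$. **Corollary 8.8.** Let $\zeta_1,\zeta_2\in\mathbb C$ and suppose that $\zeta_1$ or $\zeta_2$ is generic. Then the set $$\{(a-\zeta_1 b)(a-\zeta_2 b) : a,b\in\mathfrak G\}$$ is dense in $\mathbb C$. -/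

import Mathlib

namespace Hurwitz

/-- A choice function of the Hurwitz (nearest integer) algorithm, i.e. the multivalued nearest
Gaussian integer function together with some fixed tie-breaking convention. -/
def IsNearestChoice (f : ℂ → GaussianInt) : Prop :=
  ∀ (z : ℂ) (γ : GaussianInt), ‖z - (f z : ℂ)‖ ≤ ‖z - (γ : ℂ)‖

open Classical in
/-- The sequence `z₀ = z`, `zₙ₊₁ = (zₙ - f zₙ)⁻¹`, terminated (`none` from then on) after the first
`zₙ` with `f zₙ = zₙ`. -/
noncomputable def iterate (f : ℂ → GaussianInt) (z : ℂ) : ℕ → Option ℂ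
  | 0 => some z
  | n + 1 => (iterate f z n).bind fun w =>
      if (f w : ℂ) = w then none else some (w - (f w : ℂ))⁻¹

/-- The `n`-th partial quotient `aₙ = f zₙ` of `z`; `none` if the expansion stopped before. -/
noncomputable def partialQuotient (f : ℂ → GaussianInt) (z : ℂ) (n : ℕ) : Option GaussianInt :=
  (iterate f z n).map f

/-- The block `β = (b₁, …, b_l)` occurs in the expansion of `z` starting at position `k`. -/
def OccursAt (f : ℂ → GaussianInt) (z : ℂ) (β : List GaussianInt) (k : ℕ) : Prop :=
  ∀ (i : ℕ) (h : i < β.length), partialQuotient f z (k + i) = some β[i]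

/-- The open unit square `S` centred at `0`. -/
def square : Set ℂ := {z | |z.re| < 1 / 2 ∧ |z.im| < 1 / 2}

/-- `S_β`: the points of `S` whose expansion satisfies `(a₁, …, a_l) = β`. -/
def cylinder (f : ℂ → GaussianInt) (β : List GaussianInt) : Set ℂ :=
  {z | z ∈ square ∧ OccursAt f z β 1}

/-- A block is admissible if its entries have absolute value greater than `1` and `S_β` has
nonempty interior. -/
def Admissible (f : ℂ → GaussianInt) (β : List GaussianInt) : Prop :=
  (∀ b ∈ β, 1 < ‖(b : ℂ)‖) ∧ (interior (cylinder f β)).Nonempty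

/-- `z` is generic: it is not rational (real or imaginary part irrational) and every admissible
block occurs in its Hurwitz expansion. -/
def IsGeneric (f : ℂ → GaussianInt) (z : ℂ) : Prop :=
  (Irrational z.re ∨ Irrational z.im) ∧
    ∀ β : List GaussianInt, Admissible f β → ∃ k : ℕ, OccursAt f z β k

end Hurwitz

/-! Substituting along the expansion of `ζ₁` turns the form into `(x - z y)(μ x - ν y)`, where `z`
is an iterate and `μ z - ν = ±(ζ₁ - ζ₂)` (`Represented.step`). A run of digits 10 drives `ν - ω μ`
to 0, where `ω = 5 - √26` is fixed by `z ↦ 1/(z - 10)` (`Represented.exists_of_replicate`). Digits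
of a point near `t` placed after the run force `z` near `t` (`exists_robust`,
`norm_sub_le_of_occursAt`). Such blocks are admissible, so genericity supplies them.

Up to sign, the value at `(10, 1)` then approaches `(10 - t)(10 - ω)(ζ₁ - ζ₂)/(t - ω)`, which covers
a neighbourhood of 0 as `t` varies near 10. Multiplying by squares of integers reaches all of `ℂ`.
If `ζ₁ = ζ₂`, the values are squares of a linear form with dense range. -/

namespace Hurwitz

/-! ### The nearest integer function -/

theorem toComplex_re (a : GaussianInt) : (a : ℂ).re = a.re :=
  (GaussianInt.intCast_re a).symm

theorem toComplex_im (a : GaussianInt) : (a : ℂ).im = a.im :=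
  (GaussianInt.intCast_im a).symm

theorem toComplex_ten : ((10 : GaussianInt) : ℂ) = 10 :=
  map_ofNat GaussianInt.toComplex 10

theorem IsNearestChoice.abs_re_le {f : ℂ → GaussianInt} (hf : IsNearestChoice f) (z : ℂ) :
    |(z - (f z : ℂ)).re| ≤ 1 / 2 := by
  have h1 := hf z (f z + 1)
  have h2 := hf z (f z - 1)
  rw [← sq_le_sq₀ (norm_nonneg _) (norm_nonneg _), Complex.sq_norm, Complex.sq_norm,
    Complex.normSq_apply, Complex.normSq_apply] at h1 h2
  simp at h1 h2
  rw [abs_le]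
  constructor <;> simp <;> nlinarith

theorem IsNearestChoice.abs_im_le {f : ℂ → GaussianInt} (hf : IsNearestChoice f) (z : ℂ) :
    |(z - (f z : ℂ)).im| ≤ 1 / 2 := by
  have h1 := hf z (f z + ⟨0, 1⟩)
  have h2 := hf z (f z - ⟨0, 1⟩)
  rw [← sq_le_sq₀ (norm_nonneg _) (norm_nonneg _), Complex.sq_norm, Complex.sq_norm,
    Complex.normSq_apply, Complex.normSq_apply] at h1 h2
  simp at h1 h2
  rw [abs_le]
  constructor <;> simp <;> nlinarith

theorem IsNearestChoice.sq_norm_sub_le {f : ℂ → GaussianInt} (hf : IsNearestChoice f) (z : ℂ) :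
    ‖z - (f z : ℂ)‖ ^ 2 ≤ 1 / 2 := by
  have h1 := sq_le_sq' (by linarith [abs_nonneg (z - (f z : ℂ)).re]) (hf.abs_re_le z)
  have h2 := sq_le_sq' (by linarith [abs_nonneg (z - (f z : ℂ)).im]) (hf.abs_im_le z)
  rw [sq_abs] at h1 h2
  rw [Complex.sq_norm, Complex.normSq_apply]
  nlinarith

theorem IsNearestChoice.norm_sub_le {f : ℂ → GaussianInt} (hf : IsNearestChoice f) (z : ℂ) :
    ‖z - (f z : ℂ)‖ ≤ 3 / 4 := by
  have := hf.sq_norm_sub_le z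
  nlinarith [norm_nonneg (z - (f z : ℂ))]

theorem IsNearestChoice.eq_of_sub_mem_square {f : ℂ → GaussianInt} (hf : IsNearestChoice f)
    {z : ℂ} {a : GaussianInt} (h : z - (a : ℂ) ∈ square) : f z = a := by
  obtain ⟨h1, h2⟩ := h
  have h3 := hf.abs_re_le z
  have h4 := hf.abs_im_le z
  simp only [Complex.sub_re, Complex.sub_im, toComplex_re,
    toComplex_im] at h1 h2 h3 h4
  rw [abs_lt] at h1 h2
  rw [abs_le] at h3 h4
  have key : ∀ (x : ℝ) (m n : ℤ), -(1 / 2) < x - m ∧ x - m < 1 / 2 →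
      -(1 / 2) ≤ x - n ∧ x - n ≤ 1 / 2 → n = m := by
    intro x m n hm hn
    have h5 : (n : ℝ) < m + 1 := by linarith
    have h6 : (m : ℝ) < n + 1 := by linarith
    norm_cast at h5 h6
    omega
  exact Zsqrtd.ext (key _ _ _ h1 h3) (key _ _ _ h2 h4)

theorem isOpen_square : IsOpen square := by
  have h1 : IsOpen {z : ℂ | |z.re| < 1 / 2} :=
    isOpen_lt (Complex.continuous_re.abs) continuous_const
  have h2 : IsOpen {z : ℂ | |z.im| < 1 / 2} :=
    isOpen_lt (Complex.continuous_im.abs) continuous_const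
  exact h1.inter h2

theorem mem_square_of_norm_lt {z : ℂ} (h : ‖z‖ < 1 / 2) : z ∈ square :=
  ⟨(Complex.abs_re_le_norm z).trans_lt h, (Complex.abs_im_le_norm z).trans_lt h⟩

/-! ### Iterates and occurrences of blocks -/

theorem iterate_add (f : ℂ → GaussianInt) (z : ℂ) (k n : ℕ) :
    iterate f z (k + n) = (iterate f z k).bind fun w => iterate f w n := by
  induction n with
  | zero => simp [iterate]
  | succ n ih =>
    rw [← add_assoc, iterate, ih]
    cases iterate f z k <;> simp [iterate]

theorem iterate_succ_of_ne {f : ℂ → GaussianInt} {z : ℂ} (h : (f z : ℂ) ≠ z) (n : ℕ) :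
    iterate f z (n + 1) = iterate f (z - (f z : ℂ))⁻¹ n := by
  rw [add_comm, iterate_add]
  simp [iterate, h]

theorem iterate_eq_some_of_succ {f : ℂ → GaussianInt} {z u : ℂ} {n : ℕ}
    (h : iterate f z (n + 1) = some u) :
    ∃ w, iterate f z n = some w ∧ (f w : ℂ) ≠ w ∧ u = (w - (f w : ℂ))⁻¹ := by
  rw [iterate, Option.bind_eq_some_iff] at h
  obtain ⟨w, hw, h⟩ := h
  split_ifs at h with hfw
  exact ⟨w, hw, hfw, by simpa using h.symm⟩

theorem OccursAt.exists_iterate {f : ℂ → GaussianInt} {z : ℂ} {β γ : List GaussianInt} {k : ℕ}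
    (h : OccursAt f z (β ++ γ) k) (hγ : γ ≠ []) :
    ∃ w, iterate f z (k + β.length) = some w ∧ OccursAt f w γ 0 := by
  have hpos : 0 < γ.length := List.length_pos_iff.2 hγ
  have h0 := h β.length (by simp [hpos])
  rw [partialQuotient, Option.map_eq_some_iff] at h0
  obtain ⟨w, hw, -⟩ := h0
  refine ⟨w, hw, fun i hi => ?_⟩
  have h1 := h (β.length + i) (by simpa using hi)
  rw [partialQuotient, ← add_assoc, iterate_add, hw] at h1
  simpa [partialQuotient] using h1

theorem OccursAt.of_append {f : ℂ → GaussianInt} {z : ℂ} {β γ : List GaussianInt} {k : ℕ}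
    (h : OccursAt f z (β ++ γ) k) : OccursAt f z β k := by
  intro i hi
  have := h i (by simp; omega)
  rwa [List.getElem_append_left hi] at this

theorem OccursAt.head_eq {f : ℂ → GaussianInt} {z : ℂ} {a : GaussianInt} {β : List GaussianInt}
    (h : OccursAt f z (a :: β) 0) : f z = a := by
  exact Option.some_injective _ (h 0 (by simp))

theorem OccursAt.tail {f : ℂ → GaussianInt} {z : ℂ} {a b : GaussianInt} {β : List GaussianInt}
    (h : OccursAt f z (a :: b :: β) 0) :
    (a : ℂ) ≠ z ∧ OccursAt f (z - (a : ℂ))⁻¹ (b :: β) 0 := by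
  have ha := h.head_eq
  obtain ⟨w, hw, hocc⟩ := OccursAt.exists_iterate (β := [a]) (γ := b :: β) h (by simp)
  simp only [List.length_singleton] at hw
  obtain ⟨u, hu, hne, rfl⟩ := iterate_eq_some_of_succ hw
  obtain rfl : z = u := by simpa [iterate] using hu
  rw [ha] at hne hocc
  exact ⟨hne, hocc⟩

theorem occursAt_cons {f : ℂ → GaussianInt} {z : ℂ} {a : GaussianInt} {β : List GaussianInt}
    (ha : f z = a) (hne : (a : ℂ) ≠ z) (h : OccursAt f (z - (a : ℂ))⁻¹ β 0) :
    OccursAt f z (a :: β) 0 := by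
  subst ha
  rintro (_ | i) hi
  · simp [partialQuotient, iterate]
  · have := h i (by simpa using hi)
    simp only [zero_add, partialQuotient] at this ⊢
    rw [iterate_succ_of_ne hne, this]
    simp

/-- Points whose expansions share a long initial block are close to each other. -/
theorem norm_sub_le_of_occursAt {f : ℂ → GaussianInt} (hf : IsNearestChoice f)
    {β : List GaussianInt} {b : GaussianInt} {z w : ℂ} (hz : OccursAt f z (b :: β) 0)
    (hw : OccursAt f w (b :: β) 0) : ‖z - w‖ ≤ 2 * (3 / 4) ^ β.length := by
  induction β generalizing b z w with
  | nil =>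
    have h1 := hf.norm_sub_le z
    have h2 := hf.norm_sub_le w
    rw [hz.head_eq] at h1
    rw [hw.head_eq] at h2
    have := norm_sub_le (z - (b : ℂ)) (w - b)
    rw [sub_sub_sub_cancel_right] at this
    simp
    linarith
  | cons c β ih =>
    obtain ⟨hz0, hz1⟩ := hz.tail
    obtain ⟨hw0, hw1⟩ := hw.tail
    have h := ih hz1 hw1
    have h1 := hf.norm_sub_le z
    have h2 := hf.norm_sub_le w
    rw [hz.head_eq] at h1
    rw [hw.head_eq] at h2
    have hz0 := sub_ne_zero.2 hz0.symm
    have hw0 := sub_ne_zero.2 hw0.symm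
    have key : z - w = -((z - b) * (w - b) * ((z - b)⁻¹ - (w - b)⁻¹)) := by
      field_simp
      ring
    rw [key, norm_neg, norm_mul, norm_mul, List.length_cons, pow_succ]
    have h3 : ‖z - (b : ℂ)‖ * ‖w - (b : ℂ)‖ ≤ 3 / 4 := by
      nlinarith [norm_nonneg (z - (b : ℂ)), norm_nonneg (w - (b : ℂ))]
    exact (mul_le_mul h3 h (norm_nonneg _) (by norm_num)).trans_eq (by ring)

/-! ### Robust expansions -/

/-- `β` is an initial block of the expansion of `z`, and no iterate involved meets the boundary of
a fundamental square or a Gaussian integer. -/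
def Robust : List GaussianInt → ℂ → Prop
  | [], _ => True
  | a :: β, z => z - (a : ℂ) ∈ square ∧ z ≠ a ∧ Robust β (z - (a : ℂ))⁻¹

theorem isOpen_robust (β : List GaussianInt) : IsOpen {z | Robust β z} := by
  induction β with
  | nil => simp [Robust]
  | cons a β ih =>
    rw [isOpen_iff_mem_nhds]
    rintro z ⟨h1, h2, h3⟩
    have c1 : ContinuousAt (fun z : ℂ => z - a) z := by fun_prop
    have c2 : ContinuousAt (fun z : ℂ => (z - a)⁻¹) z := c1.inv₀ (sub_ne_zero.2 h2)
    filter_upwards [c1.eventually_mem (isOpen_square.mem_nhds h1), isOpen_ne.mem_nhds h2,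
      c2.eventually_mem (ih.mem_nhds h3)] with w w1 w2 w3
    exact ⟨w1, w2, w3⟩

theorem Robust.occursAt {f : ℂ → GaussianInt} (hf : IsNearestChoice f) {β : List GaussianInt}
    {z : ℂ} (h : Robust β z) : OccursAt f z β 0 := by
  induction β generalizing z with
  | nil => intro i hi; simp at hi
  | cons a β ih =>
    obtain ⟨h1, h2, h3⟩ := h
    exact occursAt_cons (hf.eq_of_sub_mem_square h1) h2.symm (ih h3)

/-- If `|a| ≤ 1`, then `a` is 0 or a unit, and `|1 - a s| < |s|`. This is absurd for `a = 0`; for a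
unit it says `Re (a s) > 1/2`, impossible in the square. -/
theorem one_lt_norm_of_inv_sub_mem_square {s : ℂ} {a : GaussianInt} (hs : s ∈ square)
    (hs0 : s ≠ 0) (h : s⁻¹ - (a : ℂ) ∈ square) : 1 < ‖(a : ℂ)‖ := by
  by_contra hcon
  have hN : ‖(a : ℂ)‖ ^ 2 ≤ 1 := by
    nlinarith [norm_nonneg (a : ℂ)]
  have hn : ‖s⁻¹ - (a : ℂ)‖ ^ 2 < 1 := by
    obtain ⟨h1, h2⟩ := h
    rw [abs_lt] at h1 h2
    rw [Complex.sq_norm, Complex.normSq_apply]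
    nlinarith
  have hlt : ‖1 - (a : ℂ) * s‖ ^ 2 < ‖s‖ ^ 2 := by
    have : 1 - (a : ℂ) * s = (s⁻¹ - a) * s := by
      field_simp
    rw [this, norm_mul, mul_pow]
    have : 0 < ‖s‖ ^ 2 := by positivity
    nlinarith
  obtain ⟨h1, h2⟩ := hs
  rw [abs_lt] at h1 h2
  rw [Complex.sq_norm, Complex.normSq_apply] at hN
  rw [Complex.sq_norm, Complex.sq_norm, Complex.normSq_apply, Complex.normSq_apply] at hlt
  obtain ⟨m, n⟩ := a
  simp only [toComplex_re, toComplex_im, Complex.sub_re, Complex.sub_im,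
    Complex.mul_re, Complex.mul_im, Complex.one_re, Complex.one_im] at hN hlt
  norm_cast at hN
  have hm1 : m ≤ 1 := by nlinarith
  have hm2 : -1 ≤ m := by nlinarith
  have hn1 : n ≤ 1 := by nlinarith
  have hn2 : -1 ≤ n := by nlinarith
  interval_cases m <;> interval_cases n <;> first | omega | (norm_num at hlt; nlinarith)

theorem Robust.one_lt_norm {β : List GaussianInt} {s : ℂ} (hs : s ∈ square) (hs0 : s ≠ 0)
    (h : Robust β s⁻¹) : ∀ b ∈ β, 1 < ‖(b : ℂ)‖ := by
  induction β generalizing s with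
  | nil => simp
  | cons a β ih =>
    obtain ⟨h1, h2, h3⟩ := h
    intro b hb
    rcases List.mem_cons.1 hb with rfl | hb
    · exact one_lt_norm_of_inv_sub_mem_square hs hs0 h1
    · exact ih h1 (sub_ne_zero.2 h2) h3 b hb

theorem Robust.admissible {f : ℂ → GaussianInt} (hf : IsNearestChoice f) {β : List GaussianInt}
    {s : ℂ} (hs : s ∈ square) (hs0 : s ≠ 0) (h : Robust β s⁻¹) : Admissible f β := by
  refine ⟨h.one_lt_norm hs hs0, s, ?_⟩
  rw [mem_interior_iff_mem_nhds]
  have c : ContinuousAt (fun z : ℂ => z⁻¹) s := continuousAt_inv₀ hs0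
  filter_upwards [isOpen_square.mem_nhds hs, isOpen_ne.mem_nhds hs0,
    c.eventually_mem ((isOpen_robust β).mem_nhds h)] with w w1 w2 w3
  have hfw : f w = 0 := hf.eq_of_sub_mem_square (by simpa using w1)
  -- Cylinders read digits from position 1; the digit at position 0 of a point of the square is 0.
  have hocc : OccursAt f w (0 :: β) 0 :=
    occursAt_cons hfw (by simpa using w2.symm) (by simpa using Robust.occursAt hf w3)
  refine ⟨w1, fun i hi => ?_⟩
  have := hocc (i + 1) (by simpa using hi)
  simpa [add_comm] using this

theorem exists_irrational_mem {W : Set ℂ} (hW : IsOpen W) (hne : W.Nonempty) :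
    ∃ z ∈ W, Irrational z.re ∧ Irrational z.im := by
  have hd : Dense ({x : ℝ | Irrational x} ×ˢ {x : ℝ | Irrational x}) :=
    dense_irrational.prod dense_irrational
  have hc : Continuous fun p : ℝ × ℝ => (p.1 : ℂ) + p.2 * Complex.I := by fun_prop
  have ho : IsOpen (Set.preimage (fun p : ℝ × ℝ => (p.1 : ℂ) + p.2 * Complex.I) W) :=
    hW.preimage hc
  obtain ⟨z, hz⟩ := hne
  obtain ⟨p, hp, hp1, hp2⟩ := hd.inter_open_nonempty _ ho
    ⟨(z.re, z.im), by simpa using hz⟩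
  exact ⟨_, hp, by simpa using hp1, by simpa using hp2⟩

/-- Irrational coordinates keep a point off the boundary of its fundamental square for one step.
Pulling `W` back along `u ↦ u⁻¹ + a` leaves a nonempty open set, in which a fresh irrational point
is chosen for the next step. -/
theorem exists_robust {f : ℂ → GaussianInt} (hf : IsNearestChoice f) (l : ℕ) {W : Set ℂ}
    (hW : IsOpen W) (hne : W.Nonempty) :
    ∃ β : List GaussianInt, β.length = l ∧ ∃ z ∈ W, Robust β z := by
  induction l generalizing W with
  | zero => exact ⟨[], rfl, hne.some, hne.some_mem, trivial⟩
  | succ l ih =>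
    obtain ⟨z, hz, hre, him⟩ := exists_irrational_mem hW hne
    set a := f z with ha
    have key : ∀ (x : ℝ) (m : ℤ), Irrational x → |x - m| ≤ 1 / 2 → |x - m| < 1 / 2 := by
      intro x m hx h
      refine lt_of_le_of_ne h fun h => ?_
      rcases eq_or_eq_neg_of_abs_eq h with h | h
      · exact hx ⟨m + 1 / 2, by push_cast; linarith⟩
      · exact hx ⟨m - 1 / 2, by push_cast; linarith⟩
    have hsq : z - (a : ℂ) ∈ square := by
      have h1 := hf.abs_re_le z
      have h2 := hf.abs_im_le z
      rw [← ha] at h1 h2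
      simp only [Complex.sub_re, Complex.sub_im, toComplex_re,
        toComplex_im] at h1 h2
      refine ⟨?_, ?_⟩
      · simpa using key _ _ hre h1
      · simpa using key _ _ him h2
    have hza : z - (a : ℂ) ≠ 0 := by
      intro h
      refine hre ⟨a.re, ?_⟩
      have := congrArg Complex.re h
      simp at this
      simp
      linarith
    let W' : Set ℂ := interior {u | u ≠ 0 ∧ u⁻¹ ∈ square ∧ u⁻¹ + a ∈ W}
    have hW' : (z - (a : ℂ))⁻¹ ∈ W' := by
      rw [mem_interior_iff_mem_nhds]
      have hu : (z - (a : ℂ))⁻¹ ≠ 0 := inv_ne_zero hza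
      have c : ContinuousAt (fun u : ℂ => u⁻¹) (z - (a : ℂ))⁻¹ := continuousAt_inv₀ hu
      have c' : ContinuousAt (fun u : ℂ => u⁻¹ + a) (z - (a : ℂ))⁻¹ := c.add continuousAt_const
      filter_upwards [isOpen_ne.mem_nhds hu,
        c.eventually_mem (isOpen_square.mem_nhds (by simpa using hsq)),
        c'.eventually_mem (hW.mem_nhds (by simpa using hz))] with u u1 u2 u3
      exact ⟨u1, u2, u3⟩
    obtain ⟨β, hβ, u, hu, hrob⟩ := ih isOpen_interior ⟨_, hW'⟩
    obtain ⟨u1, u2, u3⟩ := interior_subset hu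
    refine ⟨a :: β, by simp [hβ], u⁻¹ + a, u3, ?_, ?_, ?_⟩
    · simpa using u2
    · simpa using u1
    · simpa using hrob

/-! ### Prefixing runs of the digit 10 -/

theorem Robust.exists_replicate_append {β : List GaussianInt} {z : ℂ} (h : Robust β z)
    (hz : 5 ≤ ‖z‖) (m : ℕ) :
    ∃ w : ℂ, 5 ≤ ‖w‖ ∧ Robust (List.replicate m 10 ++ β) w := by
  induction m with
  | zero => exact ⟨z, hz, by simpa using h⟩
  | succ m ih =>
    obtain ⟨w, hw, hr⟩ := ih
    have hw0 : w ≠ 0 := by rintro rfl; norm_num at hw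
    have hwi : ‖w⁻¹‖ ≤ 1 / 5 := by
      rw [norm_inv, ← one_div]
      exact one_div_le_one_div_of_le (by norm_num) hw
    refine ⟨10 + w⁻¹, ?_, ?_⟩
    · have := norm_sub_le_norm_add (10 : ℂ) w⁻¹
      norm_num at this hwi ⊢
      linarith
    · rw [List.replicate_succ, List.cons_append]
      refine ⟨?_, ?_, ?_⟩
      · rw [toComplex_ten, add_sub_cancel_left]
        exact mem_square_of_norm_lt (by linarith)
      · rw [toComplex_ten]
        simpa using hw0
      · rw [toComplex_ten, add_sub_cancel_left, inv_inv]
        exact hr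

theorem Robust.admissible_replicate_append {f : ℂ → GaussianInt} (hf : IsNearestChoice f)
    {β : List GaussianInt} {z : ℂ} (h : Robust β z) (hz : 5 ≤ ‖z‖) (m : ℕ) :
    Admissible f (List.replicate m 10 ++ β) := by
  obtain ⟨w, hw, hr⟩ := h.exists_replicate_append hz m
  have hw0 : w ≠ 0 := by rintro rfl; norm_num at hw
  refine Robust.admissible hf (s := w⁻¹) (mem_square_of_norm_lt ?_) (inv_ne_zero hw0)
    (by simpa using hr)
  rw [norm_inv, ← one_div]
  exact (one_div_le_one_div_of_le (by norm_num) hw).trans_lt (by norm_num)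

/-! ### Forms equivalent to the given one -/

/-- The values of the form `(a - ζ₁ b) (a - ζ₂ b)` at pairs of Gaussian integers. -/
def formValues (ζ₁ ζ₂ : ℂ) : Set ℂ :=
  {w | ∃ a b : GaussianInt, w = ((a : ℂ) - ζ₁ * (b : ℂ)) * ((a : ℂ) - ζ₂ * (b : ℂ))}

theorem formValues_comm (ζ₁ ζ₂ : ℂ) : formValues ζ₁ ζ₂ = formValues ζ₂ ζ₁ := by
  ext w
  constructor <;> rintro ⟨a, b, rfl⟩ <;> exact ⟨a, b, mul_comm _ _⟩

theorem sq_mul_mem_formValues {ζ₁ ζ₂ w : ℂ} (h : w ∈ formValues ζ₁ ζ₂) (c : GaussianInt) :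
    (c : ℂ) ^ 2 * w ∈ formValues ζ₁ ζ₂ := by
  obtain ⟨a, b, rfl⟩ := h
  exact ⟨c * a, c * b, by rw [map_mul, map_mul]; ring⟩

theorem neg_mem_formValues {ζ₁ ζ₂ w : ℂ} (h : w ∈ formValues ζ₁ ζ₂) : -w ∈ formValues ζ₁ ζ₂ := by
  have := sq_mul_mem_formValues h ⟨0, 1⟩
  rwa [GaussianInt.toComplex_def₂, show (⟨((0 : ℤ) : ℝ), ((1 : ℤ) : ℝ)⟩ : ℂ) = Complex.I by
    apply Complex.ext <;> simp, Complex.I_sq, neg_one_mul] at this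

/-- The form `(x - z y) (μ x - ν y)` represents only values of the form with roots `ζ₁`, `ζ₂`, and
up to sign the two have the same root of the discriminant. -/
def Represented (ζ₁ ζ₂ z μ ν : ℂ) : Prop :=
  (μ * z - ν = ζ₁ - ζ₂ ∨ μ * z - ν = -(ζ₁ - ζ₂)) ∧
    ∀ x y : GaussianInt, ((x : ℂ) - z * y) * (μ * x - ν * y) ∈ formValues ζ₁ ζ₂

/-- This is the substitution `(x, y) ↦ (a x + y, x)`; its determinant is -1, hence the sign in
`Represented`. -/
theorem Represented.step {ζ₁ ζ₂ z μ ν : ℂ} (h : Represented ζ₁ ζ₂ z μ ν) {a : GaussianInt}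
    (ha : z - (a : ℂ) ≠ 0) :
    Represented ζ₁ ζ₂ (z - (a : ℂ))⁻¹ (-((z - a) * (μ * a - ν))) ((z - a) * μ) := by
  obtain ⟨h1, h2⟩ := h
  constructor
  · have : -((z - a) * (μ * a - ν)) * (z - (a : ℂ))⁻¹ - (z - a) * μ = -(μ * z - ν) := by
      field_simp
      ring
    rw [this]
    rcases h1 with h1 | h1 <;> rw [h1] <;> simp
  · intro x y
    have := h2 (a * x + y) x
    convert this using 1
    rw [map_add, map_mul]
    field_simp
    ring

theorem Represented.norm_eq {ζ₁ ζ₂ z μ ν : ℂ} (h : Represented ζ₁ ζ₂ z μ ν) :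
    ‖μ * z - ν‖ = ‖ζ₁ - ζ₂‖ := by
  rcases h.1 with h | h <;> rw [h]
  rw [norm_neg]

theorem exists_represented {f : ℂ → GaussianInt} (hf : IsNearestChoice f) (ζ₁ ζ₂ : ℂ) {n : ℕ}
    {z : ℂ} (hz : iterate f ζ₁ n = some z) :
    ∃ μ ν, Represented ζ₁ ζ₂ z μ ν ∧ ‖μ‖ ≤ 3 / 2 * ‖ζ₁ - ζ₂‖ + (1 / 2) ^ n := by
  induction n generalizing z with
  | zero =>
    obtain rfl : ζ₁ = z := by simpa [iterate] using hz
    refine ⟨1, ζ₂, ⟨by simp, fun x y => ⟨x, y, by ring⟩⟩, ?_⟩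
    simp
  | succ n ih =>
    obtain ⟨w, hw, hne, rfl⟩ := iterate_eq_some_of_succ hz
    obtain ⟨μ, ν, hrep, hμ⟩ := ih hw
    refine ⟨_, _, hrep.step (sub_ne_zero.2 hne.symm), ?_⟩
    -- As `|w - f w|² ≤ 1/2`, the map `x ↦ x/2 + (3/4)|ζ₁ - ζ₂|` bounds the growth of `|μ|`; its
    -- fixed point is `(3/2)|ζ₁ - ζ₂|`.
    have e : -((w - f w) * (μ * f w - ν)) = (w - f w) ^ 2 * μ - (w - f w) * (μ * w - ν) := by ring
    rw [e]
    refine (norm_sub_le _ _).trans ?_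
    rw [norm_mul, norm_mul, norm_pow, hrep.norm_eq]
    have h1 := hf.sq_norm_sub_le w
    have h2 := hf.norm_sub_le w
    calc _ ≤ 1 / 2 * (3 / 2 * ‖ζ₁ - ζ₂‖ + (1 / 2) ^ n) + 3 / 4 * ‖ζ₁ - ζ₂‖ := by gcongr
      _ = _ := by ring

/-- Along a run of partial quotients `10` the second root approaches the fixed point `ω`. -/
theorem Represented.exists_of_replicate {f : ℂ → GaussianInt} (hf : IsNearestChoice f)
    {ζ₁ ζ₂ z μ ν ω : ℂ} (hω : ω ^ 2 = 10 * ω + 1) (hω' : ‖ω‖ ≤ 1 / 2)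
    (h : Represented ζ₁ ζ₂ z μ ν) {m : ℕ} {u : ℂ} (hocc : OccursAt f z (List.replicate m 10) 0)
    (hu : iterate f z m = some u) :
    ∃ μ' ν', Represented ζ₁ ζ₂ u μ' ν' ∧ ‖ν' - ω * μ'‖ ≤ (1 / 2) ^ m * ‖ν - ω * μ‖ := by
  induction m generalizing u with
  | zero =>
    obtain rfl : z = u := by simpa [iterate] using hu
    exact ⟨μ, ν, h, by simp⟩
  | succ m ih =>
    obtain ⟨w, hw, hne, rfl⟩ := iterate_eq_some_of_succ hu
    obtain ⟨μ', ν', hrep, hle⟩ := ih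
      (by rw [List.replicate_succ'] at hocc; exact hocc.of_append) hw
    have h10 : f w = 10 := by
      have := hocc m (by simp)
      simpa [partialQuotient, hw] using this
    refine ⟨_, _, hrep.step (sub_ne_zero.2 hne.symm), ?_⟩
    have h1 := hf.norm_sub_le w
    rw [h10] at h1 ⊢
    rw [toComplex_ten] at h1 ⊢
    -- The quadratic equation of `ω` makes each step multiply the error by `-(w - 10) ω`, of modulus
    -- at most 1/2.
    have e : (w - 10) * μ' - ω * -((w - 10) * (μ' * 10 - ν')) =
        -((w - 10) * ω * (ν' - ω * μ')) := by
      linear_combination (-(w - 10) * μ') * hω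
    rw [e, norm_neg, norm_mul, norm_mul, pow_succ]
    calc _ ≤ 1 * (1 / 2) * ((1 / 2) ^ m * ‖ν - ω * μ‖) := by
          gcongr
          linarith
      _ = _ := by ring

/-- Two-sided control at a generic root: the first root is close to a prescribed point of large
modulus, the second one to `ω`. -/
theorem IsGeneric.exists_represented_near {f : ℂ → GaussianInt} (hf : IsNearestChoice f)
    {ζ₁ ζ₂ ω t : ℂ} (hζ : IsGeneric f ζ₁) (hne : ζ₁ ≠ ζ₂) (hω : ω ^ 2 = 10 * ω + 1)
    (hω' : ‖ω‖ ≤ 1 / 2) (ht : 5 < ‖t‖) {δ : ℝ} (hδ : 0 < δ) :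
    ∃ z μ ν, Represented ζ₁ ζ₂ z μ ν ∧ ‖z - t‖ < δ ∧ ‖ν - ω * μ‖ < δ := by
  have hD : 0 < ‖ζ₁ - ζ₂‖ := norm_pos_iff.2 (sub_ne_zero.2 hne)
  obtain ⟨n₀, hn₀⟩ := exists_pow_lt_of_lt_one hD (show (1 / 2 : ℝ) < 1 by norm_num)
  obtain ⟨l, hl⟩ := exists_pow_lt_of_lt_one (show 0 < δ / 4 by positivity)
    (show (3 / 4 : ℝ) < 1 by norm_num)
  have hB : 0 < 100 * ‖ζ₁ - ζ₂‖ := by positivity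
  obtain ⟨m, hm⟩ := exists_pow_lt_of_lt_one (show 0 < δ / (100 * ‖ζ₁ - ζ₂‖) by positivity)
    (show (1 / 2 : ℝ) < 1 by norm_num)
  have hopen : IsOpen (Metric.ball t (δ / 2) ∩ {z : ℂ | 5 < ‖z‖}) :=
    Metric.isOpen_ball.inter (isOpen_lt continuous_const continuous_norm)
  obtain ⟨β, hβ, s, ⟨hst, hs5⟩, hrob⟩ := exists_robust hf (l + 1) hopen
    ⟨t, Metric.mem_ball_self (by positivity), ht⟩
  obtain _ | ⟨b, β⟩ := β
  · simp at hβ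
  have hβ : β.length = l := by simpa using hβ
  -- The position `k` is uncontrolled: the first `n₀` digits make `(1/2)^(k + n₀)` negligible in the
  -- bound on `μ`, and the other `m + 1` contract the error. The extra 1 guarantees that `w` has
  -- first digit 10, hence `|w| ≤ 11`, even for `m = 0`.
  obtain ⟨k, hk⟩ := hζ.2 _ (hrob.admissible_replicate_append hf (le_of_lt hs5) (n₀ + (m + 1)))
  rw [List.replicate_add, List.append_assoc] at hk
  obtain ⟨w, hw, hwocc⟩ := hk.exists_iterate (by simp)
  obtain ⟨μ, ν, hrep, hμ⟩ := exists_represented hf ζ₁ ζ₂ hw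
  rw [List.length_replicate] at hw hμ
  obtain ⟨u, hu, huocc⟩ := hwocc.exists_iterate (by simp)
  rw [List.length_replicate, zero_add] at hu
  obtain ⟨μ', ν', hrep', hle⟩ := hrep.exists_of_replicate hf hω hω' hwocc.of_append hu
  refine ⟨u, μ', ν', hrep', ?_, ?_⟩
  · have h1 := norm_sub_le_of_occursAt hf huocc (hrob.occursAt hf)
    rw [hβ] at h1
    have h2 : ‖s - t‖ < δ / 2 := by simpa [dist_eq_norm] using hst
    have h3 := norm_sub_le_norm_sub_add_norm_sub u s t
    linarith
  · have hμ' : ‖μ‖ ≤ 5 / 2 * ‖ζ₁ - ζ₂‖ := by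
      have : (1 / 2 : ℝ) ^ (k + n₀) ≤ (1 / 2) ^ n₀ :=
        pow_le_pow_of_le_one (by norm_num) (by norm_num) (by omega)
      linarith
    have hw10 : ‖w‖ ≤ 11 := by
      have h1 := hf.norm_sub_le w
      rw [List.replicate_succ, List.cons_append] at hwocc
      rw [hwocc.head_eq] at h1
      have h2 := norm_le_norm_sub_add w ((10 : GaussianInt) : ℂ)
      have h3 : ‖((10 : GaussianInt) : ℂ)‖ = 10 := by rw [toComplex_ten]; norm_num
      linarith
    have hν : ‖ν - ω * μ‖ ≤ 100 * ‖ζ₁ - ζ₂‖ := by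
      have e : ν - ω * μ = (w - ω) * μ - (μ * w - ν) := by ring
      rw [e]
      refine (norm_sub_le _ _).trans ?_
      rw [norm_mul, hrep.norm_eq]
      have h4 : ‖w - ω‖ ≤ 12 := (norm_sub_le _ _).trans (by linarith)
      calc _ ≤ 12 * (5 / 2 * ‖ζ₁ - ζ₂‖) + ‖ζ₁ - ζ₂‖ := by gcongr
        _ ≤ _ := by linarith
    have hm' : (1 / 2 : ℝ) ^ (m + 1) ≤ (1 / 2) ^ m :=
      pow_le_pow_of_le_one (by norm_num) (by norm_num) (by omega)
    calc _ ≤ _ := hle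
      _ ≤ (1 / 2) ^ m * (100 * ‖ζ₁ - ζ₂‖) := by gcongr
      _ < δ := by rwa [lt_div_iff₀ hB] at hm

/-! ### Density for distinct roots -/

theorem exists_fixed_point : ∃ ω : ℂ, ω ^ 2 = 10 * ω + 1 ∧ ‖ω‖ ≤ 1 / 2 := by
  have h0 : (0 : ℝ) ≤ √26 := Real.sqrt_nonneg _
  have h1 : √26 ^ 2 = (26 : ℝ) := Real.sq_sqrt (by norm_num)
  refine ⟨((5 - √26 : ℝ) : ℂ), ?_, ?_⟩
  · norm_cast
    linear_combination h1
  · rw [Complex.norm_real, Real.norm_eq_abs, abs_le]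
    constructor <;> nlinarith

theorem IsGeneric.dense_formValues_of_ne {f : ℂ → GaussianInt} (hf : IsNearestChoice f)
    {ζ₁ ζ₂ : ℂ} (hζ : IsGeneric f ζ₁) (hne : ζ₁ ≠ ζ₂) : Dense (formValues ζ₁ ζ₂) := by
  obtain ⟨ω, hω, hω'⟩ := exists_fixed_point
  set D := ζ₁ - ζ₂ with hDdef
  have hD : D ≠ 0 := sub_ne_zero.2 hne
  have hκ : 10 - ω ≠ 0 := by
    intro h
    rw [← sub_eq_zero.1 h] at hω'
    norm_num at hω'
  have hDκ : D * (10 - ω) ≠ 0 := mul_ne_zero hD hκ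
  intro v
  have hv : Filter.Tendsto (fun n : ℕ => v / ((n : ℂ) + 1) ^ 2) Filter.atTop (nhds 0) := by
    have h1 : Filter.Tendsto (fun n : ℕ => 1 / ((n : ℂ) + 1)) Filter.atTop (nhds 0) :=
      tendsto_one_div_add_atTop_nhds_zero_nat
    have h2 := (h1.mul h1).const_mul v
    simp only [mul_zero] at h2
    refine h2.congr fun n => ?_
    field_simp
  -- The quotient is the solution `t` of `(10 - t)(10 - ω) D = v' (t - ω)`. It tends to 10 as `v' →
  -- 0`, so `|t| > 5` for small `v'`.
  have hT : ContinuousAt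
      (fun v' : ℂ => (10 * (D * (10 - ω)) + v' * ω) / (v' + D * (10 - ω))) 0 := by
    refine ContinuousAt.div (by fun_prop) (by fun_prop) (by simpa using hDκ)
  have hT0 : (10 * (D * (10 - ω)) + 0 * ω) / (0 + D * (10 - ω)) = 10 := by
    rw [zero_mul, add_zero, zero_add, mul_div_cancel_right₀ _ hDκ]
  have hden : ∀ᶠ v' : ℂ in nhds 0, v' + D * (10 - ω) ≠ 0 := by
    have c : ContinuousAt (fun v' : ℂ => v' + D * (10 - ω)) 0 := by fun_prop
    exact c.eventually_ne (by simpa using hDκ)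
  have hball : ∀ᶠ v' : ℂ in nhds 0,
      (10 * (D * (10 - ω)) + v' * ω) / (v' + D * (10 - ω)) ∈ {z : ℂ | 5 < ‖z‖} :=
    hT.eventually_mem ((isOpen_lt continuous_const continuous_norm).mem_nhds
      (by rw [hT0]; norm_num))
  obtain ⟨N, hN1, hN2⟩ := (hv.eventually (hden.and hball)).exists
  set v' := v / ((N : ℂ) + 1) ^ 2 with hv'
  set t := (10 * (D * (10 - ω)) + v' * ω) / (v' + D * (10 - ω)) with ht
  have hN0 : (N : ℂ) + 1 ≠ 0 := Nat.cast_add_one_ne_zero N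
  have htω : t - ω ≠ 0 := by
    intro h
    have h5 : 5 < ‖t‖ := hN2
    rw [sub_eq_zero.1 h] at h5
    linarith
  -- With `e = ν - ω μ`, the relation `μ z - ν = D` gives `μ = (D + e)/(z - ω)`, so `G (z, e)` is
  -- the value at `(10, 1)`. The opposite sign of `D` amounts to negating `μ`, `ν` and the value.
  let G : ℂ × ℂ → ℂ := fun p => (10 - p.1) * ((10 - ω) * (D + p.2) / (p.1 - ω) - p.2)
  have hG : ContinuousAt G (t, 0) := by
    have c : ContinuousAt (fun p : ℂ × ℂ => (10 - ω) * (D + p.2) / (p.1 - ω)) (t, 0) :=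
      ContinuousAt.div (by fun_prop) (by fun_prop) htω
    exact ContinuousAt.mul (by fun_prop) (c.sub (by fun_prop))
  have hGv : G (t, 0) = v' := by
    have h1 : t * (v' + D * (10 - ω)) = 10 * (D * (10 - ω)) + v' * ω := by
      rw [ht, div_mul_cancel₀ _ hN1]
    simp only [G, add_zero, sub_zero]
    field_simp
    linear_combination -h1
  rw [Metric.mem_closure_iff]
  intro ε hε
  have hNpos : 0 < ‖((N : ℂ) + 1) ^ 2‖ := norm_pos_iff.2 (pow_ne_zero 2 hN0)
  have hNε : 0 < ε / ‖((N : ℂ) + 1) ^ 2‖ := div_pos hε hNpos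
  obtain ⟨δ, hδ, hGδ⟩ := Metric.continuousAt_iff.1 hG _ hNε
  rw [hGv] at hGδ
  obtain ⟨z, μ, ν, hrep, hz, hν⟩ :=
    hζ.exists_represented_near hf hne hω hω' hN2 (lt_min hδ (sub_pos.2 hN2))
  have hzω : z - ω ≠ 0 := by
    intro h
    rw [sub_eq_zero.1 h, norm_sub_rev] at hz
    have h1 := lt_of_lt_of_le hz (min_le_right _ _)
    have h2 := norm_sub_norm_le t ω
    linarith
  have hval := hrep.2 10 1
  rw [toComplex_ten, map_one, mul_one, mul_one] at hval
  have hmain : ∃ w ∈ formValues ζ₁ ζ₂, dist w v' < ε / ‖((N : ℂ) + 1) ^ 2‖ := by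
    have hz' : dist z t < δ := by
      rw [dist_eq_norm]
      exact lt_of_lt_of_le hz (min_le_left _ _)
    have hν' : ‖ν - ω * μ‖ < δ := lt_of_lt_of_le hν (min_le_left _ _)
    rcases hrep.1 with h | h
    · refine ⟨_, hval, ?_⟩
      have h1 : (10 - z) * (μ * 10 - ν) = G (z, ν - ω * μ) := by
        simp only [G]
        field_simp
        linear_combination ((10 - z) * (10 - ω)) * h
      rw [h1]
      apply hGδ
      rw [Prod.dist_eq]
      exact max_lt hz' (by simpa using hν')
    · refine ⟨_, neg_mem_formValues hval, ?_⟩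
      have h1 : -((10 - z) * (μ * 10 - ν)) = G (z, -(ν - ω * μ)) := by
        simp only [G]
        field_simp
        linear_combination (-(10 - z) * (10 - ω)) * h
      rw [h1]
      apply hGδ
      rw [Prod.dist_eq]
      exact max_lt hz' (by rw [dist_eq_norm, sub_zero, norm_neg]; exact hν')
  obtain ⟨w, hw, hd⟩ := hmain
  refine ⟨_, sq_mul_mem_formValues hw ((N : GaussianInt) + 1), ?_⟩
  have h1 : v - (((N : GaussianInt) + 1 : GaussianInt) : ℂ) ^ 2 * w =
      -(((N : ℂ) + 1) ^ 2 * (w - v')) := by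
    rw [hv', map_add, map_natCast, map_one]
    field_simp
    ring
  rw [dist_eq_norm, h1, norm_neg, norm_mul, mul_comm, ← dist_eq_norm]
  rwa [lt_div_iff₀ hNpos] at hd

/-! ### The degenerate form -/

theorem exists_linear_form {f : ℂ → GaussianInt} (hf : IsNearestChoice f) (ζ : ℂ) {n : ℕ}
    {z : ℂ} (hz : iterate f ζ n = some z) :
    ∃ r : ℂ, r ≠ 0 ∧ ‖r‖ ≤ (3 / 4) ^ n ∧
      ∀ x y : GaussianInt, ∃ a b : GaussianInt, (a : ℂ) - ζ * b = r * (x - z * y) := by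
  induction n generalizing z with
  | zero =>
    obtain rfl : ζ = z := by simpa [iterate] using hz
    exact ⟨1, one_ne_zero, by simp, fun x y => ⟨x, y, by simp⟩⟩
  | succ n ih =>
    obtain ⟨w, hw, hne, rfl⟩ := iterate_eq_some_of_succ hz
    obtain ⟨r, hr, hle, h⟩ := ih hw
    have h0 : w - f w ≠ 0 := sub_ne_zero.2 hne.symm
    refine ⟨-(r * (w - f w)), neg_ne_zero.2 (mul_ne_zero hr h0), ?_, fun x y => ?_⟩
    · rw [norm_neg, norm_mul, pow_succ]
      gcongr
      exact hf.norm_sub_le w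
    · obtain ⟨a, b, hab⟩ := h (f w * x + y) x
      refine ⟨a, b, hab.trans ?_⟩
      rw [map_add, map_mul]
      field_simp
      ring

/-- Arbitrarily long runs of 10 occur, so the expansion reaches iterates of arbitrarily high index;
there the form takes all values in `r ℤ[i]`, a lattice of arbitrarily small mesh. -/
theorem IsGeneric.dense_linear_form {f : ℂ → GaussianInt} (hf : IsNearestChoice f) {ζ : ℂ}
    (hζ : IsGeneric f ζ) :
    DenseRange fun p : GaussianInt × GaussianInt => (p.1 : ℂ) - ζ * p.2 := by
  intro v
  rw [Metric.mem_closure_iff]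
  intro ε hε
  obtain ⟨m, hm⟩ := exists_pow_lt_of_lt_one hε (show (3 / 4 : ℝ) < 1 by norm_num)
  have hrob : Robust [] (5 : ℂ) := trivial
  obtain ⟨k, hk⟩ := hζ.2 _
    (hrob.admissible_replicate_append hf (by norm_num) (m + 1))
  rw [List.append_nil, List.replicate_add] at hk
  obtain ⟨w, hw, -⟩ := hk.exists_iterate (by simp)
  rw [List.length_replicate] at hw
  obtain ⟨r, hr, hle, h⟩ := exists_linear_form hf ζ hw
  obtain ⟨a, b, hab⟩ := h (f (v / r)) 0
  refine ⟨_, ⟨(a, b), rfl⟩, ?_⟩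
  have h1 := hf.norm_sub_le (v / r)
  have h2 : v - r * ((f (v / r) : ℂ) - w * (0 : GaussianInt)) = r * (v / r - f (v / r)) := by
    rw [map_zero]
    field_simp
    simp
  have h3 : (3 / 4 : ℝ) ^ (k + m) ≤ (3 / 4) ^ m :=
    pow_le_pow_of_le_one (by norm_num) (by norm_num) (by omega)
  simp only [hab]
  rw [dist_eq_norm, h2, norm_mul]
  nlinarith [norm_nonneg r, norm_nonneg (v / r - f (v / r))]

theorem IsGeneric.dense_formValues_self {f : ℂ → GaussianInt} (hf : IsNearestChoice f) {ζ : ℂ}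
    (hζ : IsGeneric f ζ) : Dense (formValues ζ ζ) := by
  have hsurj : Function.Surjective fun z : ℂ => z ^ 2 := fun v => by
    obtain ⟨s, hs⟩ := IsAlgClosed.exists_pow_nat_eq v (n := 2) (by norm_num)
    exact ⟨s, hs⟩
  have hd := hsurj.denseRange.comp (hζ.dense_linear_form hf) (continuous_pow 2)
  refine Dense.mono ?_ hd
  rintro _ ⟨⟨a, b⟩, rfl⟩
  exact ⟨a, b, by simp [sq]⟩

theorem IsGeneric.dense_formValues {f : ℂ → GaussianInt} (hf : IsNearestChoice f) {ζ₁ : ℂ}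
    (hζ : IsGeneric f ζ₁) (ζ₂ : ℂ) : Dense (formValues ζ₁ ζ₂) := by
  by_cases h : ζ₁ = ζ₂
  · subst h
    exact hζ.dense_formValues_self hf
  · exact hζ.dense_formValues_of_ne hf h

end Hurwitz

theorem corollary8p8 (f : ℂ → GaussianInt) (hf : Hurwitz.IsNearestChoice f) (ζ₁ ζ₂ : ℂ)
    (hζ : Hurwitz.IsGeneric f ζ₁ ∨ Hurwitz.IsGeneric f ζ₂) :
    Dense {w : ℂ | ∃ a b : GaussianInt,
      w = ((a : ℂ) - ζ₁ * (b : ℂ)) * ((a : ℂ) - ζ₂ * (b : ℂ))} := by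
  change Dense (Hurwitz.formValues ζ₁ ζ₂)
  rcases hζ with h | h
  · exact h.dense_formValues hf ζ₂
  · rw [Hurwitz.formValues_comm]
    exact h.dense_formValues hf ζ₁
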